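/- Let $\mathbb{F}$ be a field with $\operatorname{char}\mathbb{F}\neq 2$. A unital associative $\mathbb{F}$-algebra $A$ is called a (unital) locally matrix algebra if every finite subset of $A$ is contained in a subalgebra isomorphic to the matrix algebra $M_n(\mathbb{F})$ for some $n\ge 1$. For $a\in A$ choose a subalgebra $A'\subseteq A$ with $1_A,a\in A'$ and $A'\cong M_n(\mathbb{F})$; the normalized rank of $a$ is $\overline{r}(a)=r(a)/n$, where $r(a)$ is the rank of $a$ regarded as an $n\times n$ matrix; it does not depend on the choice of $A'$ or of the isomorphism. Let $A$ and $B$ be unital locally matrix algebras over $\mathbb{F}$, and let $\varphi\colon A\to B$ be an $\mathbb{F}$-linear map that preserves the normalized rank, that is, $\overline{r}(\varphi(a))=\overline{r}(a)$ for all $a\in A$. Then there exist idempotents $e_1,e_2\in B$ with $e_1e_2=e_2e_1=0$ and $e_1+e_2=1_B$ (one of them may be zero), an $\mathbb{F}$-linear homomorphism $\varphi_1\colon A\to e_1Be_1$ with $\varphi_1(1_A)=e_1$, an $\mathbb{F}$-linear antihomomorphism $\varphi_2\colon A\to e_2Be_2$ (that is, $\varphi_2(ab)=\varphi_2(b)\varphi_2(a)$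 for all $a,b\in A$) with $\varphi_2(1_A)=e_2$, and invertible elements $X,Y\in B$ such that $$\varphi(a)=X\bigl(\varphi_1(a)+\varphi_2(a)\bigr)Y\qquad\text{for all } a\in A.$$ -/

import Mathlib

/-- A unital algebra `A` over a field `F` is locally matrix if every finite subset of `A` lies in a
subalgebra isomorphic to `M_n(F)` for some `n ≥ 1`. Since the identity may be adjoined to the
finite set, the subalgebras may be taken to contain `1`, as `Subalgebra` does. -/
def IsLocallyMatrix (F A : Type*) [Field F] [Ring A] [Algebra F A] : Prop :=
  ∀ s : Finset A, ∃ n : ℕ, 1 ≤ n ∧ ∃ S : Subalgebra F A,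
    (s : Set A) ⊆ S ∧ Nonempty (S ≃ₐ[F] Matrix (Fin n) (Fin n) F)

/-- `q = r(a) / n`, where `r(a)` is the rank of `a` as an element of some subalgebra of `A` that
contains `1` and `a` and is isomorphic to `M_n(F)`, `n ≥ 1`. -/
def HasNormalizedRank (F : Type*) {A : Type*} [Field F] [Ring A] [Algebra F A]
    (a : A) (q : ℚ) : Prop :=
  ∃ n : ℕ, 1 ≤ n ∧ ∃ (S : Subalgebra F A) (e : S ≃ₐ[F] Matrix (Fin n) (Fin n) F) (ha : a ∈ S),
    q = ((e ⟨a, ha⟩).rank : ℚ) / (n : ℚ)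

open Classical in
/-- The normalized rank of an element. In a locally matrix algebra it exists and does not depend on
the subalgebra that is used to compute it: see `HasNormalizedRank.normalizedRank_eq` and
`IsLocallyMatrix.hasNormalizedRank`. -/
noncomputable def normalizedRank (F : Type*) {A : Type*} [Field F] [Ring A] [Algebra F A]
    (a : A) : ℚ :=
  if h : ∃ q, HasNormalizedRank F a q then h.choose else 0

theorem IsLocallyMatrix.hasNormalizedRank {F A : Type*} [Field F] [Ring A] [Algebra F A]
    (hA : IsLocallyMatrix F A) (a : A) : HasNormalizedRank F a (normalizedRank F a) := by
  have h : ∃ q, HasNormalizedRank F a q := by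
    obtain ⟨n, hn, S, hs, ⟨e⟩⟩ := hA {a}
    exact ⟨_, n, hn, S, e, hs (by simp), rfl⟩
  rw [normalizedRank, dif_pos h]
  exact h.choose_spec

open scoped Matrix in
/-- The rank is additive on orthogonal idempotent matrices. -/
theorem rank_add_of_orthogonal {F : Type*} [Field F] {k : ℕ} {p q : Matrix (Fin k) (Fin k) F}
    (hp : p * p = p) (hq : q * q = q) (hpq : p * q = 0) (hqp : q * p = 0) :
    (p + q).rank = p.rank + q.rank := by
  apply le_antisymm
  · rw [Matrix.rank, Matrix.rank, Matrix.rank, Matrix.mulVecLin_add]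
    refine le_trans (Submodule.finrank_mono (LinearMap.range_add_le _ _)) ?_
    exact Submodule.finrank_add_le_finrank_add_finrank _ _
  · have hinf : LinearMap.range p.mulVecLin ⊓ LinearMap.range q.mulVecLin = ⊥ := by
      rw [eq_bot_iff]
      rintro _ ⟨⟨x, rfl⟩, ⟨y, hy⟩⟩
      simp only [Matrix.mulVecLin_apply] at hy
      have : p *ᵥ (p *ᵥ x) = 0 := by rw [← hy, Matrix.mulVec_mulVec, hpq, Matrix.zero_mulVec]
      rw [Matrix.mulVec_mulVec, hp] at this
      simpa using this
    have hle : LinearMap.range p.mulVecLin ⊔ LinearMap.range q.mulVecLin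
        ≤ LinearMap.range (p + q).mulVecLin := by
      refine sup_le ?_ ?_
      · rintro _ ⟨x, rfl⟩
        exact ⟨p *ᵥ x, by simp [Matrix.mulVec_mulVec, hp, hqp]⟩
      · rintro _ ⟨x, rfl⟩
        exact ⟨q *ᵥ x, by simp [Matrix.mulVec_mulVec, hq, hpq]⟩
    have h1 := Submodule.finrank_sup_add_finrank_inf_eq
      (LinearMap.range p.mulVecLin) (LinearMap.range q.mulVecLin)
    have h2 := Submodule.finrank_mono hle
    rw [hinf, finrank_bot, add_zero] at h1
    rw [Matrix.rank, Matrix.rank, Matrix.rank, ← h1]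
    exact h2

/-- A unital homomorphism of matrix algebras preserves `rank / size`. -/
theorem rank_map_mul {F : Type*} [Field F] {n k : ℕ}
    (f : Matrix (Fin n) (Fin n) F →ₐ[F] Matrix (Fin k) (Fin k) F) (M : Matrix (Fin n) (Fin n) F) :
    (f M).rank * n = M.rank * k := by
  let E : Fin n → Matrix (Fin n) (Fin n) F := fun i => Matrix.single i i 1
  have hEE : ∀ i, E i * E i = E i := fun i => by simp [E]
  have hEo : ∀ i j, i ≠ j → E i * E j = 0 := fun i j h => by
    simp [E, Matrix.single_mul_single_of_ne, h]
  have hle : ∀ i j, (f (E i)).rank ≤ (f (E j)).rank := fun i j => by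
    have : E i = Matrix.single i j 1 * E j * Matrix.single j i 1 := by simp [E]
    rw [this, map_mul, map_mul]
    exact (Matrix.rank_mul_le_left _ _).trans (Matrix.rank_mul_le_right _ _)
  have hsumE : ∀ (s : Finset (Fin n)) (j : Fin n),
      (∑ i ∈ s, E i) * (∑ i ∈ s, E i) = ∑ i ∈ s, E i ∧
      (j ∉ s → E j * (∑ i ∈ s, E i) = 0 ∧ (∑ i ∈ s, E i) * E j = 0) := by
    intro s j
    constructor
    · rw [Finset.sum_mul_sum]
      refine Finset.sum_congr rfl fun i hi => ?_
      rw [Finset.sum_eq_single_of_mem i hi (fun j _ hj => hEo i j hj.symm), hEE]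
    · intro hj
      rw [Finset.mul_sum, Finset.sum_mul]
      exact ⟨Finset.sum_eq_zero fun i hi => hEo _ _ (fun h => hj (h ▸ hi)),
        Finset.sum_eq_zero fun i hi => hEo _ _ (fun h => hj (h ▸ hi))⟩
  have hsum : ∀ (j : Fin n) (s : Finset (Fin n)),
      (f (∑ i ∈ s, E i)).rank = s.card * (f (E j)).rank := by
    intro j s
    induction s using Finset.induction_on with
    | empty => simp
    | insert a s ha ih =>
      rw [Finset.sum_insert ha, map_add, rank_add_of_orthogonal, ih, Finset.card_insert_of_notMem ha,
        le_antisymm (hle a j) (hle j a)]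
      · ring
      · rw [← map_mul, hEE]
      · rw [← map_mul, (hsumE s a).1]
      · rw [← map_mul, ((hsumE s a).2 ha).1, map_zero]
      · rw [← map_mul, ((hsumE s a).2 ha).2, map_zero]
  have hent : ∀ (s : Finset (Fin n)) (a b : Fin n),
      (∑ i ∈ s, E i) a b = if a = b ∧ a ∈ s then 1 else 0 := by
    intro s a b
    rw [Matrix.sum_apply]
    by_cases h : a = b
    · subst h
      simp [E, Matrix.single_apply]
    · rw [if_neg (fun h' => h h'.1)]
      refine Finset.sum_eq_zero fun i _ => ?_
      simp only [E, Matrix.single_apply]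
      exact if_neg (fun h' => h (h'.1.symm.trans h'.2))
  have hone : ∑ i, E i = 1 := by
    ext a b
    simp [hent, Matrix.one_apply]
  rcases Nat.eq_zero_or_pos n with rfl | hn
  · have : M.rank = 0 := by simpa using Matrix.rank_le_width M
    simp [this]
  let j : Fin n := ⟨0, hn⟩
  have hk : k = n * (f (E j)).rank := by
    have := hsum j Finset.univ
    rw [hone, map_one, Matrix.rank_one] at this
    simpa using this
  obtain ⟨V, U, e, hV, hU, hVU⟩ := M.exists_rank_normal_form
  have hP : V * M * U = ∑ i ∈ Finset.univ.filter (fun i => (e i).isLeft), E i := by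
    rw [hVU]
    ext a b
    rw [hent]
    rcases ha : e a with x | x <;> rcases hb : e b with y | y
    · have hab : a = b ↔ x = y := by
        rw [← e.injective.eq_iff, ha, hb, Sum.inl.injEq]
      simp [ha, hb, hab, Matrix.one_apply]
    · have hab : a ≠ b := fun h => by simp [h, hb] at ha
      simp [ha, hb, hab]
    · simp [ha, hb]
    · simp [ha, hb]
  have hcard : (Finset.univ.filter (fun i => (e i).isLeft)).card = M.rank := by
    have h : Finset.univ.filter (fun i => (e i).isLeft) =
        (Finset.univ : Finset (Fin M.rank)).map
          (Function.Embedding.inl.trans e.symm.toEmbedding) := by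
      ext i
      simp only [Finset.mem_filter, Finset.mem_univ, true_and, Finset.mem_map,
        Function.Embedding.trans_apply, Function.Embedding.inl_apply, Equiv.coe_toEmbedding,
        Sum.isLeft_iff, Equiv.symm_apply_eq]
      exact exists_congr fun _ => eq_comm
    rw [h, Finset.card_map, Finset.card_univ, Fintype.card_fin]
  have hfr : (f M).rank = (f (V * M * U)).rank := by
    rw [map_mul, map_mul, Matrix.rank_mul_eq_left_of_isUnit_det, Matrix.rank_mul_eq_right_of_isUnit_det]
    · exact (Matrix.isUnit_iff_isUnit_det _).1 (hV.map f)
    · exact (Matrix.isUnit_iff_isUnit_det _).1 (hU.map f)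
  rw [hfr, hP, hsum j, hcard]
  conv_rhs => rw [hk]
  ring

/-- The normalized rank does not depend on the choice of the subalgebra. -/
theorem HasNormalizedRank.unique {F A : Type*} [Field F] [Ring A] [Algebra F A]
    (hA : IsLocallyMatrix F A) {a : A} {q q' : ℚ} (h : HasNormalizedRank F a q)
    (h' : HasNormalizedRank F a q') : q = q' := by
  classical
  have key : ∀ (n : ℕ) (S : Subalgebra F A) (_ : S ≃ₐ[F] Matrix (Fin n) (Fin n) F),
      ∃ t : Finset A, ∀ T : Subalgebra F A, (t : Set A) ⊆ T → S ≤ T := by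
    intro n S e
    have : Module.Finite F S := Module.Finite.equiv e.symm.toLinearEquiv
    have hfg : (Subalgebra.toSubmodule S).FG := Module.Finite.iff_fg.mp this
    obtain ⟨t, ht⟩ := hfg
    refine ⟨t, fun T hT => ?_⟩
    have : Submodule.span F (t : Set A) ≤ Subalgebra.toSubmodule T := Submodule.span_le.mpr hT
    rw [ht] at this
    exact this
  obtain ⟨n, hn, S, e, ha, rfl⟩ := h
  obtain ⟨n', hn', S', e', ha', rfl⟩ := h'
  obtain ⟨t, ht⟩ := key n S e
  obtain ⟨t', ht'⟩ := key n' S' e'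
  obtain ⟨k, hk, T, hT, ⟨g⟩⟩ := hA (t ∪ t')
  rw [Finset.coe_union, Set.union_subset_iff] at hT
  have comp : ∀ (m : ℕ), 1 ≤ m → ∀ (R : Subalgebra F A) (d : R ≃ₐ[F] Matrix (Fin m) (Fin m) F)
      (hR : R ≤ T) (haR : a ∈ R),
      ((d ⟨a, haR⟩).rank : ℚ) / (m : ℚ) = ((g ⟨a, hR haR⟩).rank : ℚ) / (k : ℚ) := by
    intro m hm R d hR haR
    have := rank_map_mul (g.toAlgHom.comp ((Subalgebra.inclusion hR).comp d.symm.toAlgHom)) (d ⟨a, haR⟩)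
    change (g (Subalgebra.inclusion hR (d.symm (d ⟨a, haR⟩)))).rank * m = _ at this
    rw [AlgEquiv.symm_apply_apply, Subalgebra.inclusion_mk] at this
    have hm0 : (m : ℚ) ≠ 0 := by positivity
    have hk0 : (k : ℚ) ≠ 0 := by positivity
    rw [div_eq_div_iff hm0 hk0]
    exact_mod_cast this.symm
  rw [comp n hn S e (ht T hT.1) ha, comp n' hn' S' e' (ht' T hT.2) ha']

theorem HasNormalizedRank.normalizedRank_eq {F A : Type*} [Field F] [Ring A] [Algebra F A]
    (hA : IsLocallyMatrix F A) {a : A} {q : ℚ} (h : HasNormalizedRank F a q) :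
    normalizedRank F a = q :=
  HasNormalizedRank.unique hA (hA.hasNormalizedRank a) h

/-!
`φ(1)` has normalized rank `1`, so it is invertible, and `ψ = φ(1)⁻¹ φ` is unital and still
preserves the normalized rank. A square matrix `x` with `rank x + rank (1 - x)` equal to its size
is idempotent, so `ψ` preserves idempotents.

A linear map `M_n(F) → B` that preserves idempotents is a Jordan homomorphism when `2 ≠ 0`
(`map_mul_add_mul_of_map_idempotent`). For `e = e_ii` the identity
`ψ(e ∘ y) = ψ(e) ∘ ψ(y)`, with `x ∘ y = xy + yx`, is read off the Peirce decomposition of `y`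
with respect to `e`, from the idempotents `e ± y` with `y` in `e M (1 - e)` or `(1 - e) M e`
and from the idempotents orthogonal to `e`; the same then holds for the conjugates of `e_ii`, and
these span `M_n(F)`.

The images `X i j` of the matrix units have the Jordan products of matrix units. Fix an index `o`.
Cutting the column `X i o` and the row `X o j` on one side by the idempotent `X o o` gives families
`u`, `v` with `v_j u_i = δ_ij c` and `c v_j = v_j`, so `e_ij ↦ u_i v_j` is a homomorphism; the
transposed family gives an antihomomorphism, and the two add up to `X` and annihilate each other
(`exists_isHomAddAntihom_of_jordan`).

In such a decomposition `ψ = ψ₁ + ψ₂` on a matrix subalgebra, `ψ₁(ab) = ψ(a) ψ(b) ψ(ab)` whenever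
`b² = 0` and `ab` is idempotent. Taking finitely many such pairs with `∑ a_i b_i = 1`, the
element `ψ₁(1)` is the same for all matrix subalgebras that contain the `a_i` and `b_i`. It is an
idempotent `e` that commutes with `ψ(A)`, and `e ψ` and `(1 - e) ψ` are the two parts of `ψ` on all
of `A` (`exists_idempotent_split`).
-/

/-! ### Idempotents and normalized rank -/

/-- The ranges of `M` and `1 - M` span the whole space, so by dimension they meet in zero, and
`M (1 - M) = (1 - M) M` maps into both. -/
theorem Matrix.isIdempotentElem_of_rank_add_rank_le {F : Type*} [Field F] {n : ℕ}
    (M : Matrix (Fin n) (Fin n) F) (h : M.rank + (1 - M).rank ≤ n) : IsIdempotentElem M := by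
  have htop : LinearMap.range M.mulVecLin ⊔ LinearMap.range (1 - M).mulVecLin = ⊤ := by
    rw [eq_top_iff]
    intro v _
    refine Submodule.mem_sup.2 ⟨_, ⟨v, rfl⟩, _, ⟨v, rfl⟩, ?_⟩
    simp
  have hdim := Submodule.finrank_sup_add_finrank_inf_eq
    (LinearMap.range M.mulVecLin) (LinearMap.range (1 - M).mulVecLin)
  rw [htop, finrank_top, Module.finrank_fin_fun] at hdim
  have hinf : LinearMap.range M.mulVecLin ⊓ LinearMap.range (1 - M).mulVecLin = ⊥ := by
    rw [← Submodule.finrank_eq_zero (R := F)]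
    simp only [Matrix.rank] at h
    omega
  have hcomm : M * (1 - M) = (1 - M) * M := by noncomm_ring
  have hzero : M * (1 - M) = 0 := by
    apply Matrix.ext_of_mulVec_single
    intro i
    rw [Matrix.zero_mulVec]
    have : (M * (1 - M)).mulVec (Pi.single i 1) ∈
        LinearMap.range M.mulVecLin ⊓ LinearMap.range (1 - M).mulVecLin := by
      refine ⟨⟨(1 - M).mulVec (Pi.single i 1), by
          rw [Matrix.mulVecLin_apply, Matrix.mulVec_mulVec]⟩,
        ⟨M.mulVec (Pi.single i 1), by
          rw [Matrix.mulVecLin_apply, Matrix.mulVec_mulVec, hcomm]⟩⟩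
    rw [hinf] at this
    simpa using this
  rw [mul_sub, mul_one, sub_eq_zero] at hzero
  exact hzero.symm

section NormalizedRank

variable {F A B : Type*} [Field F] [Ring A] [Algebra F A] [Ring B] [Algebra F B]

theorem IsLocallyMatrix.normalizedRank_one (hA : IsLocallyMatrix F A) :
    normalizedRank F (1 : A) = 1 := by
  obtain ⟨n, hn, S, hs, ⟨e⟩⟩ := hA ∅
  refine HasNormalizedRank.normalizedRank_eq hA ⟨n, hn, S, e, S.one_mem, ?_⟩
  have : (⟨1, S.one_mem⟩ : S) = 1 := rfl
  rw [this, map_one, Matrix.rank_one, Fintype.card_fin, div_self]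
  positivity

theorem IsLocallyMatrix.isUnit_of_normalizedRank_eq_one (hA : IsLocallyMatrix F A) {a : A}
    (ha : normalizedRank F a = 1) : IsUnit a := by
  obtain ⟨n, hn, S, e, haS, h⟩ := hA.hasNormalizedRank a
  have hn0 : (n : ℚ) ≠ 0 := by positivity
  rw [ha, eq_div_iff hn0, one_mul] at h
  have hrank : (e ⟨a, haS⟩).rank = Fintype.card (Fin n) := by
    rw [Fintype.card_fin]; exact_mod_cast h.symm
  have hu : IsUnit (e ⟨a, haS⟩) := by
    rw [← Matrix.mulVec_surjective_iff_isUnit]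
    have htop : LinearMap.range (e ⟨a, haS⟩).mulVecLin = ⊤ := by
      apply Submodule.eq_top_of_finrank_eq
      rw [Module.finrank_fintype_fun_eq_card, ← hrank, Matrix.rank]
    exact LinearMap.range_eq_top.1 htop
  have := (hu.map e.symm).map S.val
  simpa using this

theorem IsLocallyMatrix.normalizedRank_units_mul (hA : IsLocallyMatrix F A) (u : Aˣ) (a : A) :
    normalizedRank F (u * a) = normalizedRank F a := by
  classical
  obtain ⟨n, hn, S, hS, ⟨e⟩⟩ := hA {↑u, ↑u⁻¹, a}
  have hu : (u : A) ∈ S := hS (by simp)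
  have hv : ((u⁻¹ : Aˣ) : A) ∈ S := hS (by simp)
  have ha : a ∈ S := hS (by simp)
  have h1 := HasNormalizedRank.normalizedRank_eq hA ⟨n, hn, S, e, ha, rfl⟩
  have h2 := HasNormalizedRank.normalizedRank_eq hA ⟨n, hn, S, e, S.mul_mem hu ha, rfl⟩
  rw [h1, h2]
  have hmul : (⟨u * a, S.mul_mem hu ha⟩ : S) = ⟨u, hu⟩ * ⟨a, ha⟩ := rfl
  have hunit : IsUnit (⟨u, hu⟩ : S) :=
    ⟨⟨⟨u, hu⟩, ⟨_, hv⟩, Subtype.ext (by simp), Subtype.ext (by simp)⟩, rfl⟩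
  rw [hmul, map_mul, Matrix.rank_mul_eq_right_of_isUnit_det]
  exact (Matrix.isUnit_iff_isUnit_det _).1 (hunit.map e)

theorem IsLocallyMatrix.normalizedRank_add_one_sub (hA : IsLocallyMatrix F A) {a : A}
    (ha : IsIdempotentElem a) : normalizedRank F a + normalizedRank F (1 - a) = 1 := by
  obtain ⟨n, hn, S, hS, ⟨e⟩⟩ := hA {a}
  have haS : a ∈ S := hS (by simp)
  have h1 := HasNormalizedRank.normalizedRank_eq hA ⟨n, hn, S, e, haS, rfl⟩
  have h2 := HasNormalizedRank.normalizedRank_eq hA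
    ⟨n, hn, S, e, S.sub_mem S.one_mem haS, rfl⟩
  have hsub : (⟨1 - a, S.sub_mem S.one_mem haS⟩ : S) = 1 - ⟨a, haS⟩ := rfl
  have hid : IsIdempotentElem (e ⟨a, haS⟩) :=
    IsIdempotentElem.map (Subtype.ext ha : IsIdempotentElem (⟨a, haS⟩ : S)) e
  have hn0 : (n : ℚ) ≠ 0 := by positivity
  rw [h1, h2, ← add_div, div_eq_one_iff_eq hn0, hsub, map_sub, map_one, ← Nat.cast_add,
    ← rank_add_of_orthogonal hid hid.one_sub (by rw [mul_sub, mul_one, hid.eq, sub_self])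
      (by rw [sub_mul, one_mul, hid.eq, sub_self]), add_sub_cancel, Matrix.rank_one,
    Fintype.card_fin]

theorem IsLocallyMatrix.isIdempotentElem_of_normalizedRank_add (hA : IsLocallyMatrix F A) {a : A}
    (ha : normalizedRank F a + normalizedRank F (1 - a) = 1) : IsIdempotentElem a := by
  obtain ⟨n, hn, S, hS, ⟨e⟩⟩ := hA {a}
  have haS : a ∈ S := hS (by simp)
  have h1 := HasNormalizedRank.normalizedRank_eq hA ⟨n, hn, S, e, haS, rfl⟩
  have h2 := HasNormalizedRank.normalizedRank_eq hA
    ⟨n, hn, S, e, S.sub_mem S.one_mem haS, rfl⟩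
  have hsub : (⟨1 - a, S.sub_mem S.one_mem haS⟩ : S) = 1 - ⟨a, haS⟩ := rfl
  have hn0 : (n : ℚ) ≠ 0 := by positivity
  rw [h1, h2, ← add_div, div_eq_one_iff_eq hn0, hsub, map_sub, map_one, ← Nat.cast_add] at ha
  have hid := Matrix.isIdempotentElem_of_rank_add_rank_le (e ⟨a, haS⟩)
    (by exact_mod_cast ha.le)
  have := (hid.map e.symm).map S.val
  simpa using this

end NormalizedRank

/-! ### Linear maps that preserve idempotents -/

section Idempotents

variable {F B ι : Type*} [Field F] [Ring B] [Algebra F B] [Fintype ι] [DecidableEq ι]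

theorem eq_zero_of_add_self_eq_zero (h2 : (2 : F) ≠ 0) {x : B} (h : x + x = 0) : x = 0 := by
  rw [← two_smul F] at h
  exact (smul_eq_zero.1 h).resolve_left h2

/-- The case of a diagonal matrix unit `e`: for `y` in `e M (1 - e)` or `(1 - e) M e` both `e + y`
and `e - y` are idempotent, and `(1 - e) M (1 - e)` is spanned by idempotents orthogonal to
`e`. -/
theorem map_single_mul_add_mul_of_map_idempotent (h2 : (2 : F) ≠ 0)
    (φ : Matrix ι ι F →ₗ[F] B)
    (hφ : ∀ M, IsIdempotentElem M → IsIdempotentElem (φ M)) (i : ι) (y : Matrix ι ι F) :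
    φ (Matrix.single i i 1 * y + y * Matrix.single i i 1) =
      φ (Matrix.single i i 1) * φ y + φ y * φ (Matrix.single i i 1) := by
  have hdiag : ∀ k : ι, IsIdempotentElem (Matrix.single k k (1 : F)) := fun k => by
    simp [IsIdempotentElem]
  -- `e` and `f` orthogonal: `e + f` is idempotent.
  have horth : ∀ e f : Matrix ι ι F, IsIdempotentElem e → IsIdempotentElem f →
      e * f = 0 → f * e = 0 → φ e * φ f + φ f * φ e = 0 := by
    intro e f he hf hef hfe
    have h := hφ (e + f) (by simp [IsIdempotentElem, add_mul, mul_add, he.eq, hf.eq, hef, hfe])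
    simp only [IsIdempotentElem, map_add, add_mul, mul_add, (hφ e he).eq, (hφ f hf).eq] at h
    rw [← sub_eq_zero] at h
    rw [← h]; abel
  have hoff : ∀ e x : Matrix ι ι F, IsIdempotentElem e → e * x + x * e = x → x * x = 0 →
      φ e * φ x + φ x * φ e = φ x := by
    intro e x he hex hx
    -- `e + x` and `e - x` are both idempotent; `φ(x)²` cancels between them.
    have h₁ := hφ (e + x) (by
      simp only [IsIdempotentElem, add_mul, mul_add, he.eq, hx]
      nth_rw 3 [← hex]; abel)
    have h₂ := hφ (e - x) (by
      simp only [IsIdempotentElem, sub_mul, mul_sub, he.eq, hx]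
      nth_rw 3 [← hex]; abel)
    simp only [IsIdempotentElem, map_add, map_sub, add_mul, mul_add, sub_mul, mul_sub,
      (hφ e he).eq] at h₁ h₂
    rw [← sub_eq_zero] at h₁ h₂ ⊢
    apply eq_zero_of_add_self_eq_zero h2
    rw [← sub_zero (0 : B)]
    nth_rw 1 [← h₁]
    rw [← h₂]
    abel
  induction y using Matrix.induction_on' with
  | h_zero => simp
  | h_add p q hp hq =>
    rw [mul_add, add_mul, add_add_add_comm, map_add, hp, hq, map_add, mul_add, add_mul,
      add_add_add_comm]
  | h_std_basis k l t =>
    have ht : Matrix.single k l t = t • Matrix.single k l (1 : F) := by simp [Matrix.smul_single]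
    rw [ht]
    simp only [mul_smul_comm, smul_mul_assoc, ← smul_add, map_smul]
    congr 1
    by_cases hk : i = k
    · subst hk
      by_cases hl : l = i
      · subst hl
        simp [(hφ _ (hdiag l)).eq]
      · rw [hoff _ _ (hdiag i) (by simp [hl]) (by simp [hl])]
        simp [hl]
    · by_cases hl : l = i
      · subst hl
        rw [hoff _ _ (hdiag l) (by simp [hk]) (by simp [hk])]
        simp [hk]
      · have hik := horth _ _ (hdiag i) (hdiag k) (by simp [hk]) (by simp [Ne.symm hk])
        by_cases hkl : k = l
        · subst hkl
          rw [hik]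
          simp [hk, hl]
        · have h := horth (Matrix.single i i 1) (Matrix.single k k 1 + Matrix.single k l 1)
            (hdiag i) (by simp [IsIdempotentElem, mul_add, add_mul, Ne.symm hkl])
            (by simp [mul_add, hk]) (by simp [add_mul, hl, Ne.symm hk])
          rw [map_add, mul_add, add_mul, add_add_add_comm, hik, zero_add] at h
          rw [h]
          simp [hk, hl]

/-- A linear map from a matrix algebra that preserves idempotents is a Jordan homomorphism. -/
theorem map_mul_add_mul_of_map_idempotent (h2 : (2 : F) ≠ 0) (φ : Matrix ι ι F →ₗ[F] B)
    (hφ : ∀ M, IsIdempotentElem M → IsIdempotentElem (φ M)) (x y : Matrix ι ι F) :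
    φ (x * y + y * x) = φ x * φ y + φ y * φ x := by
  induction x using Matrix.induction_on' with
  | h_zero => simp
  | h_add p q hp hq =>
    rw [mul_add, add_mul, add_add_add_comm, map_add, hp, hq, map_add, mul_add, add_mul,
      add_add_add_comm]
  | h_std_basis i j t =>
    have ht : Matrix.single i j t = t • Matrix.single i j (1 : F) := by simp [Matrix.smul_single]
    rw [ht]
    simp only [mul_smul_comm, smul_mul_assoc, ← smul_add, map_smul]
    congr 1
    have hi := map_single_mul_add_mul_of_map_idempotent h2 φ hφ i y
    by_cases hij : i = j
    · subst hij
      exact hi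
    -- `e_ij = (e_ii + e_ij) - e_ii`, and `e_ii + e_ij = p * e_ii * q` is conjugate to `e_ii`.
    set p : Matrix ι ι F := 1 - Matrix.single i j 1 with hp
    set q : Matrix ι ι F := 1 + Matrix.single i j 1 with hq
    have hpq : p * q = 1 := by simp [hp, hq, sub_mul, mul_add, Ne.symm hij]
    have hqp : q * p = 1 := by simp [hp, hq, mul_sub, add_mul, Ne.symm hij]
    let ψ : Matrix ι ι F →ₗ[F] B := φ ∘ₗ LinearMap.mulLeft F p ∘ₗ LinearMap.mulRight F q
    have hψ : ∀ M, ψ M = φ (p * (M * q)) := fun M => rfl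
    have hψid : ∀ M, IsIdempotentElem M → IsIdempotentElem (ψ M) := by
      intro M hM
      refine hφ _ ?_
      change p * (M * q) * (p * (M * q)) = p * (M * q)
      calc p * (M * q) * (p * (M * q)) = p * M * (q * p) * M * q := by noncomm_ring
        _ = p * (M * M) * q := by rw [hqp, mul_one]; noncomm_ring
        _ = p * (M * q) := by rw [hM.eq, mul_assoc]
    have h := map_single_mul_add_mul_of_map_idempotent h2 ψ hψid i (q * (y * p))
    have hy : p * (q * (y * p) * q) = y := by
      calc p * (q * (y * p) * q) = (p * q) * y * (p * q) := by noncomm_ring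
        _ = y := by rw [hpq, one_mul, mul_one]
    have he : p * (Matrix.single i i 1 * q) = Matrix.single i i 1 + Matrix.single i j 1 := by
      simp [hp, hq, sub_mul, mul_add, Ne.symm hij]
    have hc : p * ((Matrix.single i i 1 * (q * (y * p)) + q * (y * p) * Matrix.single i i 1) * q) =
        (Matrix.single i i 1 + Matrix.single i j 1) * y +
          y * (Matrix.single i i 1 + Matrix.single i j 1) := by
      rw [← he]
      calc _ = p * (Matrix.single i i 1 * q) * y * (p * q) +
            (p * q) * y * (p * (Matrix.single i i 1 * q)) := by noncomm_ring
        _ = _ := by rw [hpq, one_mul, mul_one]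
    rw [hψ, hψ, hψ, hy, he, hc] at h
    simp only [add_mul, mul_add, map_add] at h hi ⊢
    rw [← sub_eq_zero] at h hi ⊢
    rw [← sub_zero (0 : B)]
    nth_rw 1 [← h]
    rw [← hi]
    abel

end Idempotents

/-! ### Jordan homomorphisms of matrix algebras -/

/-- A family `X i j` in a ring with the Jordan products `x * y + y * x` of the matrix units
`e_ij`. -/
def IsJordanMatrixUnits {B ι : Type*} [Ring B] [DecidableEq ι] (X : ι → ι → B) : Prop :=
  ∀ i j k l, X i j * X k l + X k l * X i j =
    (if j = k then X i l else 0) + (if l = i then X k j else 0)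

namespace IsJordanMatrixUnits

variable {B ι : Type*} [Ring B] [DecidableEq ι] {X : ι → ι → B}

/-- Transposition is an anti-automorphism of the matrix algebra, so it preserves Jordan
products. -/
theorem swap (hX : IsJordanMatrixUnits X) : IsJordanMatrixUnits fun i j => X j i := by
  intro i j k l
  rw [hX j i l k, add_comm]
  simp only [eq_comm]

/-- The first column of the matrix units `e_ij ⊕ 0` of the homomorphic part of `X`: if `X i j`
is thought of as `e_ij ⊕ e_ji`, then `col X o k i` is `e_io ⊕ 0`. The index `k ≠ o` is used at
`i = o` only, where `e_oo ⊕ 0` is reached as `(e_ok ⊕ 0) * (e_ko ⊕ 0)`. The antihomomorphic part is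
obtained from the transposed family. -/
def col (X : ι → ι → B) (o k i : ι) : B :=
  if i = o then X o o * X o k * (X k o * X o o) else X i o * X o o

/-- The first row `e_oj ⊕ 0` of the matrix units of the homomorphic part of `X`; see `col`. -/
def row (X : ι → ι → B) (o k j : ι) : B :=
  if j = o then X o o * X o k * (X k o * X o o) else X o o * X o j

theorem col_self (o k : ι) : col X o k o = X o o * X o k * (X k o * X o o) := if_pos rfl

theorem row_self (o k : ι) : row X o k o = X o o * X o k * (X k o * X o o) := if_pos rfl

theorem col_of_ne {o i : ι} (k : ι) (hi : i ≠ o) : col X o k i = X i o * X o o := if_neg hi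

theorem row_of_ne {o j : ι} (k : ι) (hj : j ≠ o) : row X o k j = X o o * X o j := if_neg hj

theorem diag_mul_diag (hX : IsJordanMatrixUnits X) (h2 : ∀ x : B, x + x = 0 → x = 0) (i : ι) :
    X i i * X i i = X i i := by
  have h := hX i i i i
  simp only [if_true] at h
  rw [← sub_eq_zero] at h ⊢
  apply h2
  rw [← h]; abel

theorem off_mul_self (hX : IsJordanMatrixUnits X) (h2 : ∀ x : B, x + x = 0 → x = 0) {i j : ι}
    (hij : i ≠ j) : X i j * X i j = 0 := by
  apply h2
  simpa [hij, hij.symm] using hX i j i j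

theorem diag_mul_of_ne (hX : IsJordanMatrixUnits X) (h2 : ∀ x : B, x + x = 0 → x = 0)
    {i j k : ι} (hi : k ≠ i) (hj : k ≠ j) : X k k * X i j = 0 := by
  have h : X k k * X i j + X i j * X k k = 0 := by simpa [hi, hj.symm] using hX k k i j
  have hk := hX.diag_mul_diag h2 k
  have h₁ : X k k * X i j + X k k * X i j * X k k = 0 := by
    have := congrArg (X k k * ·) h
    simpa only [mul_add, ← mul_assoc, hk, mul_zero] using this
  have h₂ : X k k * X i j * X k k + X i j * X k k = 0 := by
    have := congrArg (· * X k k) h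
    simpa only [add_mul, mul_assoc, hk, zero_mul] using this
  apply h2
  calc X k k * X i j + X k k * X i j
      = (X k k * X i j + X k k * X i j * X k k) - (X k k * X i j * X k k + X i j * X k k)
        + (X k k * X i j + X i j * X k k) := by abel
    _ = 0 := by rw [h₁, h₂, h]; abel

theorem mul_diag_of_ne (hX : IsJordanMatrixUnits X) (h2 : ∀ x : B, x + x = 0 → x = 0)
    {i j k : ι} (hi : k ≠ i) (hj : k ≠ j) : X i j * X k k = 0 := by
  have h : X k k * X i j + X i j * X k k = 0 := by simpa [hi, hj.symm] using hX k k i j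
  rwa [hX.diag_mul_of_ne h2 hi hj, zero_add] at h

theorem diag_mul_add (hX : IsJordanMatrixUnits X) {i j : ι} (hij : i ≠ j) :
    X i i * X i j + X i j * X i i = X i j := by
  simpa [hij.symm] using hX i i i j

theorem mul_diag_add (hX : IsJordanMatrixUnits X) {i j : ι} (hij : i ≠ j) :
    X i j * X j j + X j j * X i j = X i j := by
  simpa [hij.symm] using hX i j j j

theorem diag_mul_off (hX : IsJordanMatrixUnits X) (h2 : ∀ x : B, x + x = 0 → x = 0) {i j : ι}
    (hij : i ≠ j) : X i i * X i j = X i j * X j j := by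
  have h₁ : X i i * X i j = X i i * X i j * X j j := by
    conv_lhs => rw [← hX.mul_diag_add hij]
    rw [mul_add, ← mul_assoc (X i i) (X j j), hX.diag_mul_of_ne h2 hij hij, zero_mul, add_zero,
      mul_assoc]
  have h₃ : X i j * X j j = X i i * X i j * X j j := by
    conv_lhs => rw [← hX.diag_mul_add hij]
    rw [add_mul, mul_assoc (X i j), hX.diag_mul_of_ne h2 hij hij, mul_zero, add_zero]
  rw [h₁, ← h₃]

theorem off_mul_diag (hX : IsJordanMatrixUnits X) (h2 : ∀ x : B, x + x = 0 → x = 0) {i j : ι}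
    (hij : i ≠ j) : X i j * X i i = X j j * X i j :=
  (hX.swap.diag_mul_off h2 hij.symm).symm

section RowCol

variable {o k : ι}

theorem diag_mul_row (hX : IsJordanMatrixUnits X) (h2 : ∀ x : B, x + x = 0 → x = 0) (j : ι) :
    X o o * row X o k j = row X o k j := by
  unfold row
  split_ifs <;> simp only [← mul_assoc, hX.diag_mul_diag h2]

theorem row_mul_diag (hX : IsJordanMatrixUnits X) (h2 : ∀ x : B, x + x = 0 → x = 0) (j : ι) :
    row X o k j * X j j = row X o k j := by
  unfold row
  split_ifs with h
  · subst h
    simp only [mul_assoc, hX.diag_mul_diag h2]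
  · rw [hX.diag_mul_off h2 (Ne.symm h), mul_assoc, hX.diag_mul_diag h2]

theorem diag_mul_col (hX : IsJordanMatrixUnits X) (h2 : ∀ x : B, x + x = 0 → x = 0) (i : ι) :
    X i i * col X o k i = col X o k i := by
  unfold col
  split_ifs with h
  · subst h
    simp only [← mul_assoc, hX.diag_mul_diag h2]
  · rw [← hX.diag_mul_off h2 h, ← mul_assoc, hX.diag_mul_diag h2]

theorem row_mul_col_of_ne (hX : IsJordanMatrixUnits X) (h2 : ∀ x : B, x + x = 0 → x = 0)
    {i j : ι} (hij : i ≠ j) : row X o k i * col X o k j = 0 := by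
  rw [← hX.row_mul_diag h2, ← hX.diag_mul_col h2 j, mul_assoc, ← mul_assoc (X i i),
    hX.diag_mul_of_ne h2 hij hij, zero_mul, mul_zero]

/-- The homomorphic and the antihomomorphic part annihilate each other. -/
theorem row_mul_col_swap (hX : IsJordanMatrixUnits X) (h2 : ∀ x : B, x + x = 0 → x = 0)
    (hk : k ≠ o) (i j : ι) : row X o k i * col (fun i j => X j i) o k j = 0 := by
  by_cases hij : i = j
  · subst hij
    unfold row col
    split_ifs with h
    · calc X o o * X o k * (X k o * X o o) * (X o o * X k o * (X o k * X o o))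
          = X o o * X o k * (X k o * (X o o * X o o * X k o)) * (X o k * X o o) := by noncomm_ring
        _ = 0 := by
          rw [hX.diag_mul_diag h2, ← hX.off_mul_diag h2 hk, ← mul_assoc (X k o),
            hX.off_mul_self h2 hk]
          noncomm_ring
    · rw [mul_assoc, ← mul_assoc (X o i), hX.off_mul_self h2 (Ne.symm h), zero_mul, mul_zero]
  · rw [← hX.row_mul_diag h2, ← hX.swap.diag_mul_col h2 j, mul_assoc, ← mul_assoc (X i i),
      hX.diag_mul_of_ne h2 hij hij, zero_mul, mul_zero]

theorem off_mul_off_mul_off (hX : IsJordanMatrixUnits X) (h2 : ∀ x : B, x + x = 0 → x = 0)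
    {i j : ι} (hij : i ≠ j) : X i j * X j i * X i j = X i j := by
  have h : X i j * X j i + X j i * X i j = X i i + X j j := by simpa using hX i j j i
  calc X i j * X j i * X i j = X i j * (X i j * X j i + X j i * X i j)
        - X i j * X i j * X j i := by noncomm_ring
    _ = X i j := by
      rw [h, hX.off_mul_self h2 hij, mul_add, hX.off_mul_diag h2 hij, add_comm,
        hX.mul_diag_add hij, zero_mul, sub_zero]

/-- The element `e_oo ⊕ 0` does not depend on the index `k` used to reach it. -/
theorem diag_mul_off_mul_off_mul_diag (hX : IsJordanMatrixUnits X)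
    (h2 : ∀ x : B, x + x = 0 → x = 0) {j : ι} (hk : k ≠ o) (hj : j ≠ o) :
    X o o * X o j * (X j o * X o o) = X o o * X o k * (X k o * X o o) := by
  by_cases hjk : j = k
  · rw [hjk]
  have h₁ : X o o * X o j = X o o * X o k * X k j := by
    have h : X o k * X k j + X k j * X o k = X o j := by simpa [hj] using hX o k k j
    rw [← h, mul_add, ← mul_assoc _ (X k j), hX.diag_mul_of_ne h2 hk.symm hj.symm, zero_mul,
      add_zero, mul_assoc]
  have h₃ : X k j * (X j o * X o o) = X k o * X o o := by
    have h : X k j * X j o + X j o * X k j = X k o := by simpa [hk.symm] using hX k j j o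
    rw [← h, add_mul, mul_assoc (X j o), hX.mul_diag_of_ne h2 hk.symm hj.symm, mul_zero,
      add_zero, mul_assoc]
  rw [h₁, mul_assoc, h₃]

theorem row_mul_col_self (hX : IsJordanMatrixUnits X) (h2 : ∀ x : B, x + x = 0 → x = 0)
    (hk : k ≠ o) (i : ι) : row X o k i * col X o k i = row X o k o := by
  by_cases hi : i = o
  · subst hi
    rw [row_self, col_self]
    calc X i i * X i k * (X k i * X i i) * (X i i * X i k * (X k i * X i i))
        = X i i * X i k * X k i * (X i i * X i i * X i k) * (X k i * X i i) := by noncomm_ring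
      _ = X i i * X i k * X k i * (X i k * X k k) * (X k i * X i i) := by
        rw [hX.diag_mul_diag h2, ← hX.diag_mul_off h2 hk.symm]
      _ = X i i * (X i k * X k i * X i k) * X k k * (X k i * X i i) := by noncomm_ring
      _ = _ := by
        rw [hX.off_mul_off_mul_off h2 hk.symm, mul_assoc (X i i), ← hX.diag_mul_off h2 hk.symm,
          ← mul_assoc, ← mul_assoc, hX.diag_mul_diag h2, mul_assoc]
  · rw [row_of_ne k hi, col_of_ne k hi, row_self, hX.diag_mul_off_mul_off_mul_diag h2 hk hi]

theorem row_self_mul_row (hX : IsJordanMatrixUnits X) (h2 : ∀ x : B, x + x = 0 → x = 0)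
    (hk : k ≠ o) (j : ι) : row X o k o * row X o k j = row X o k j := by
  by_cases hj : j = o
  · subst hj
    exact hX.row_mul_col_self h2 hk j
  · rw [row_self, ← hX.diag_mul_off_mul_off_mul_diag h2 hk hj, row_of_ne k hj]
    calc X o o * X o j * (X j o * X o o) * (X o o * X o j)
        = X o o * X o j * X j o * (X o o * X o o * X o j) := by noncomm_ring
      _ = X o o * X o j * X j o * (X o j * X j j) := by
        rw [hX.diag_mul_diag h2, ← hX.diag_mul_off h2 (Ne.symm hj)]
      _ = X o o * (X o j * X j o * X o j) * X j j := by noncomm_ring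
      _ = _ := by
        rw [hX.off_mul_off_mul_off h2 (Ne.symm hj), mul_assoc, ← hX.diag_mul_off h2 (Ne.symm hj),
          ← mul_assoc, hX.diag_mul_diag h2]

theorem col_mul_row_self (hX : IsJordanMatrixUnits X) (h2 : ∀ x : B, x + x = 0 → x = 0)
    (hk : k ≠ o) (i : ι) : col X o k i * row X o k o = col X o k i := by
  by_cases hi : i = o
  · subst hi
    exact hX.row_mul_col_self h2 hk i
  · rw [row_self, ← hX.diag_mul_off_mul_off_mul_diag h2 hk hi, col_of_ne k hi]
    calc X i o * X o o * (X o o * X o i * (X i o * X o o))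
        = X i o * (X o o * X o o * X o i) * (X i o * X o o) := by noncomm_ring
      _ = X i o * X o i * (X i i * X i o) * X o o := by
        rw [hX.diag_mul_diag h2, hX.diag_mul_off h2 (Ne.symm hi)]; simp only [mul_assoc]
      _ = X i o * X o i * X i o * (X o o * X o o) := by
        rw [hX.diag_mul_off h2 hi]; simp only [mul_assoc]
      _ = _ := by rw [hX.off_mul_off_mul_off h2 hi, hX.diag_mul_diag h2]

/-- The matrix units split as `e_ij ⊕ 0 + 0 ⊕ e_ji`. -/
theorem col_mul_row_add (hX : IsJordanMatrixUnits X) (h2 : ∀ x : B, x + x = 0 → x = 0)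
    (hk : k ≠ o) (i j : ι) :
    col X o k i * row X o k j +
      col (fun i j => X j i) o k j * row (fun i j => X j i) o k i = X i j := by
  have hc := hX.row_self_mul_row h2 hk
  have hc' := hX.col_mul_row_self h2 hk
  have hd := hX.swap.row_self_mul_row h2 hk
  have hd' := hX.swap.col_mul_row_self h2 hk
  have hcol : col X o k o = row X o k o := rfl
  have hcol' : col (fun i j => X j i) o k o = row (fun i j => X j i) o k o := rfl
  by_cases hi : i = o <;> by_cases hj : j = o
  · subst hi; subst hj
    rw [hcol, hcol', hc, hd, row_self, row_self]
    have h : X j k * X k j + X k j * X j k = X j j + X k k := by simpa using hX j k k j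
    calc X j j * X j k * (X k j * X j j) + X j j * X k j * (X j k * X j j)
        = X j j * (X j k * X k j + X k j * X j k) * X j j := by noncomm_ring
      _ = X j j := by
        rw [h, mul_add, hX.diag_mul_diag h2, hX.diag_mul_of_ne h2 hk.symm hk.symm, add_zero,
          hX.diag_mul_diag h2]
  · subst hi
    rw [hcol, hc, hd', row_of_ne k hj, col_of_ne k hj, hX.diag_mul_add (Ne.symm hj)]
  · subst hj
    rw [hc', hcol', hd, row_of_ne k hi, col_of_ne k hi, hX.mul_diag_add hi]
  · rw [row_of_ne k hi, col_of_ne k hi, row_of_ne k hj, col_of_ne k hj]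
    have ho := hX.diag_mul_diag h2 o
    have hsum : X i o * X o o * (X o o * X o j) + X o j * X o o * (X o o * X i o) =
        X i o * X o o * X o j + X o j * X o o * X i o := by
      simp only [mul_assoc]
      simp only [← mul_assoc (X o o) (X o o), ho]
    rw [hsum]
    by_cases hij : i = j
    · subst hij
      have h : X i o * X o i + X o i * X i o = X i i + X o o := by simpa using hX i o o i
      rw [← hX.diag_mul_off h2 hi, hX.off_mul_diag h2 (Ne.symm hi), mul_assoc, mul_assoc,
        ← mul_add, h, mul_add, hX.diag_mul_diag h2, hX.diag_mul_of_ne h2 hi hi, add_zero]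
    · have h : X i o * X o j + X o j * X i o = X i j := by
        simpa [Ne.symm hij] using hX i o o j
      have h₁ : X i o * X o j = X i o * X o o * X o j := by
        conv_lhs => rw [← hX.mul_diag_add hi]
        rw [add_mul, ← hX.off_mul_diag h2 hi, mul_assoc (X i o) (X i i),
          hX.diag_mul_of_ne h2 hi hij, mul_zero, add_zero]
      have h₃ : X o j * X i o = X o j * X o o * X i o := by
        conv_lhs => rw [← hX.mul_diag_add hi]
        rw [mul_add, ← hX.diag_mul_off h2 hi, ← mul_assoc, hX.mul_diag_of_ne h2 hi hij,
          zero_mul, zero_add, mul_assoc]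
      rw [← h, h₁, h₃]

end RowCol

end IsJordanMatrixUnits

section Decomposition

variable {F A B ι : Type*} [Field F] [Ring A] [Algebra F A] [Ring B] [Algebra F B]

/-- The data of a decomposition of a linear map as the sum of a homomorphism `φ₁` and an
antihomomorphism `φ₂` with `φ₁(A) φ₂(A) = 0 = φ₂(A) φ₁(A)`. No units are involved: `φ₁` and `φ₂`
need not be unital. -/
structure IsHomAddAntihom (φ φ₁ φ₂ : A →ₗ[F] B) : Prop where
  eq_add : ∀ x, φ x = φ₁ x + φ₂ x
  map_mul₁ : ∀ x y, φ₁ (x * y) = φ₁ x * φ₁ y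
  map_mul₂ : ∀ x y, φ₂ (x * y) = φ₂ y * φ₂ x
  mul_eq_zero₁₂ : ∀ x y, φ₁ x * φ₂ y = 0
  mul_eq_zero₂₁ : ∀ x y, φ₂ x * φ₁ y = 0

namespace IsHomAddAntihom

variable {φ φ₁ φ₂ : A →ₗ[F] B}

/-- The homomorphic part is expressed by the map itself: this makes decompositions on different
subalgebras agree. -/
theorem mul_mul_eq (h : IsHomAddAntihom φ φ₁ φ₂) {a b : A} (hb : b * b = 0)
    (hab : IsIdempotentElem (a * b)) : φ a * φ b * φ (a * b) = φ₁ (a * b) := by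
  have h₁ : φ a * φ b = φ₁ (a * b) + φ₂ (b * a) := by
    rw [h.eq_add, h.eq_add, add_mul, mul_add, mul_add, h.mul_eq_zero₁₂, h.mul_eq_zero₂₁,
      h.map_mul₁, h.map_mul₂, add_zero, zero_add]
  rw [h₁, h.eq_add, add_mul, mul_add, mul_add, h.mul_eq_zero₁₂, h.mul_eq_zero₂₁, ← h.map_mul₁,
    ← h.map_mul₂, hab.eq, mul_assoc a, ← mul_assoc b b, hb, zero_mul, mul_zero, map_zero]
  simp only [add_zero]

theorem map_one_mul (h : IsHomAddAntihom φ φ₁ φ₂) (x : A) : φ₁ 1 * φ x = φ₁ x := by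
  rw [h.eq_add, mul_add, h.mul_eq_zero₁₂, ← h.map_mul₁, one_mul, add_zero]

theorem mul_map_one (h : IsHomAddAntihom φ φ₁ φ₂) (x : A) : φ x * φ₁ 1 = φ₁ x := by
  rw [h.eq_add, add_mul, h.mul_eq_zero₂₁, ← h.map_mul₁, mul_one, add_zero]

theorem one_sub_mul (h : IsHomAddAntihom φ φ₁ φ₂) (x : A) : (1 - φ₁ 1) * φ x = φ₂ x := by
  rw [sub_mul, h.map_one_mul, one_mul, h.eq_add, add_sub_cancel_left]

theorem comp {A' : Type*} [Ring A'] [Algebra F A'] (h : IsHomAddAntihom φ φ₁ φ₂)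
    (f : A' →ₐ[F] A) :
    IsHomAddAntihom (φ ∘ₗ f.toLinearMap) (φ₁ ∘ₗ f.toLinearMap) (φ₂ ∘ₗ f.toLinearMap) where
  eq_add x := h.eq_add (f x)
  map_mul₁ x y := by simp [h.map_mul₁]
  map_mul₂ x y := by simp [h.map_mul₂]
  mul_eq_zero₁₂ x y := h.mul_eq_zero₁₂ _ _
  mul_eq_zero₂₁ x y := h.mul_eq_zero₂₁ _ _

end IsHomAddAntihom

variable [Fintype ι]

/-- The linear map with `e_ij ↦ u i * v j`. -/
def Matrix.colRowMap (F : Type*) [Field F] [Algebra F B] (u v : ι → B) :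
    Matrix ι ι F →ₗ[F] B where
  toFun M := ∑ i, ∑ j, M i j • (u i * v j)
  map_add' M N := by simp only [Matrix.add_apply, add_smul, Finset.sum_add_distrib]
  map_smul' t M := by
    simp only [Matrix.smul_apply, smul_assoc, Finset.smul_sum, RingHom.id_apply]

theorem Matrix.colRowMap_apply (u v : ι → B) (M : Matrix ι ι F) :
    Matrix.colRowMap F u v M = ∑ i, ∑ j, M i j • (u i * v j) := rfl

theorem Matrix.colRowMap_mul_eq_zero {u v u' v' : ι → B} (h : ∀ i j, v i * u' j = 0)
    (M N : Matrix ι ι F) :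
    Matrix.colRowMap F u v M * Matrix.colRowMap F u' v' N = 0 := by
  have key : ∀ i j k l, u i * v j * (u' k * v' l) = 0 := by
    intro i j k l
    rw [mul_assoc, ← mul_assoc (v j), h, zero_mul, mul_zero]
  simp only [Matrix.colRowMap_apply, Finset.sum_mul, Finset.mul_sum, smul_mul_smul_comm, key,
    smul_zero, Finset.sum_const_zero]

variable [DecidableEq ι]

theorem Matrix.colRowMap_mul {u v : ι → B} {c : B} (hvu : ∀ i, v i * u i = c)
    (hvu0 : ∀ i j, i ≠ j → v i * u j = 0) (hc : ∀ j, c * v j = v j) (M N : Matrix ι ι F) :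
    Matrix.colRowMap F u v (M * N) = Matrix.colRowMap F u v M * Matrix.colRowMap F u v N := by
  have key : ∀ i j k l, u i * v j * (u k * v l) = if j = k then u i * v l else 0 := by
    intro i j k l
    rw [mul_assoc, ← mul_assoc (v j)]
    split_ifs with h
    · rw [h, hvu, hc]
    · rw [hvu0 j k h, zero_mul, mul_zero]
  simp only [Matrix.colRowMap_apply, Finset.sum_mul, Finset.mul_sum, smul_mul_smul_comm, key,
    smul_ite, smul_zero, Matrix.mul_apply, Finset.sum_smul]
  simp only [Finset.sum_ite_eq', Finset.mem_univ, if_true]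
  rw [Finset.sum_congr rfl fun x _ => Finset.sum_comm, Finset.sum_comm]
  exact Finset.sum_congr rfl fun i _ => Finset.sum_comm

/-- A Jordan homomorphism from a matrix algebra of size at least two is the sum of a homomorphism
and an antihomomorphism (Jacobson and Rickart). -/
theorem exists_isHomAddAntihom_of_jordan [Nontrivial ι] (h2 : (2 : F) ≠ 0)
    (φ : Matrix ι ι F →ₗ[F] B) (hφ : ∀ x y, φ (x * y + y * x) = φ x * φ y + φ y * φ x) :
    ∃ φ₁ φ₂ : Matrix ι ι F →ₗ[F] B, IsHomAddAntihom φ φ₁ φ₂ := by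
  obtain ⟨o, k, hk⟩ := exists_pair_ne ι
  replace hk := hk.symm
  have h2' : ∀ x : B, x + x = 0 → x = 0 := fun x => eq_zero_of_add_self_eq_zero h2
  let X : ι → ι → B := fun i j => φ (Matrix.single i j 1)
  let X' : ι → ι → B := fun i j => X j i
  have hX : IsJordanMatrixUnits X := by
    intro i j k l
    simp only [X]
    rw [← hφ, map_add]
    congr 1
    · split_ifs with h
      · subst h; simp
      · simp [h]
    · split_ifs with h
      · subst h; simp
      · simp [h]
  have hX' : IsJordanMatrixUnits X' := hX.swap
  open IsJordanMatrixUnits in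
  refine ⟨Matrix.colRowMap F (col X o k) (row X o k),
    Matrix.colRowMap F (col X' o k) (row X' o k) ∘ₗ
      (Matrix.transposeLinearEquiv ι ι F F).toLinearMap, ?_, ?_, ?_, ?_, ?_⟩
  · intro M
    have hM : φ M = ∑ i, ∑ j, M i j • X i j := by
      conv_lhs => rw [Matrix.matrix_eq_sum_single M]
      simp only [map_sum, X, ← map_smul, Matrix.smul_single, smul_eq_mul, mul_one]
    have hT : Matrix.colRowMap F (col X' o k) (row X' o k) M.transpose =
        ∑ i, ∑ j, M i j • (col X' o k j * row X' o k i) := by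
      rw [Matrix.colRowMap_apply, Finset.sum_comm]
      rfl
    change _ = _ + Matrix.colRowMap F (col X' o k) (row X' o k) M.transpose
    rw [hM, hT, Matrix.colRowMap_apply, ← Finset.sum_add_distrib]
    refine Finset.sum_congr rfl fun i _ => ?_
    rw [← Finset.sum_add_distrib]
    refine Finset.sum_congr rfl fun j _ => ?_
    conv_lhs => rw [← hX.col_mul_row_add h2' hk i j, smul_add]
  · exact Matrix.colRowMap_mul (hX.row_mul_col_self h2' hk)
      (fun i j => hX.row_mul_col_of_ne h2') (hX.row_self_mul_row h2' hk)
  · intro M N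
    change Matrix.colRowMap F _ _ (M * N).transpose = _
    rw [Matrix.transpose_mul]
    exact Matrix.colRowMap_mul (hX'.row_mul_col_self h2' hk)
      (fun i j => hX'.row_mul_col_of_ne h2') (hX'.row_self_mul_row h2' hk) _ _
  · exact fun M N => Matrix.colRowMap_mul_eq_zero (hX.row_mul_col_swap h2' hk) _ _
  · exact fun M N => Matrix.colRowMap_mul_eq_zero (hX'.row_mul_col_swap h2' hk) _ _

end Decomposition

/-! ### From matrix subalgebras to the whole algebra -/

section Gluing

variable {F A B : Type*} [Field F] [Ring A] [Algebra F A] [Ring B] [Algebra F B]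

theorem exists_eq_algebraMap_of_algEquiv_matrix_one {S : Subalgebra F A}
    (e : S ≃ₐ[F] Matrix (Fin 1) (Fin 1) F) {x : A} (hx : x ∈ S) : ∃ t : F, x = algebraMap F A t := by
  refine ⟨e ⟨x, hx⟩ 0 0, ?_⟩
  have h : e ⟨x, hx⟩ = algebraMap F _ (e ⟨x, hx⟩ 0 0) := by
    ext i j
    fin_cases i; fin_cases j
    simp [Matrix.algebraMap_matrix_apply]
  have h' := congrArg e.symm h
  rw [AlgEquiv.symm_apply_apply, AlgEquiv.commutes] at h'
  exact congrArg Subtype.val h'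

theorem exists_isHomAddAntihom_subalgebra (h2 : (2 : F) ≠ 0) (ψ : A →ₗ[F] B) (hψ1 : ψ 1 = 1)
    (hψ : ∀ a, IsIdempotentElem a → IsIdempotentElem (ψ a)) {n : ℕ} (hn : 1 ≤ n)
    (S : Subalgebra F A) (e : S ≃ₐ[F] Matrix (Fin n) (Fin n) F) :
    ∃ ψ₁ ψ₂ : S →ₗ[F] B, IsHomAddAntihom (ψ ∘ₗ S.val.toLinearMap) ψ₁ ψ₂ := by
  rcases hn.eq_or_lt with rfl | hn
  · refine ⟨ψ ∘ₗ S.val.toLinearMap, 0, by simp, fun x y => ?_, by simp, by simp, by simp⟩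
    obtain ⟨t, ht⟩ := exists_eq_algebraMap_of_algEquiv_matrix_one e x.2
    simp [ht, Algebra.algebraMap_eq_smul_one, hψ1]
  · have : Nontrivial (Fin n) := Fin.nontrivial_iff_two_le.2 hn
    let f : Matrix (Fin n) (Fin n) F →ₐ[F] A := S.val.comp e.symm.toAlgHom
    obtain ⟨φ₁, φ₂, h⟩ := exists_isHomAddAntihom_of_jordan h2 (ψ ∘ₗ f.toLinearMap)
      (map_mul_add_mul_of_map_idempotent h2 _ fun M hM => hψ _ (hM.map f))
    have h' := h.comp e.toAlgHom
    have hf : ψ ∘ₗ S.val.toLinearMap = (ψ ∘ₗ f.toLinearMap) ∘ₗ e.toAlgHom.toLinearMap := by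
      ext x
      simp [f]
    rw [hf]
    exact ⟨_, _, h'⟩

/-- A matrix algebra of size at least two has `1 = ∑ a_i b_i` with `a_i = e_ij`, `b_i = e_ji`,
`j ≠ i`. -/
theorem exists_sum_mul_eq_one {n : ℕ} (hn : 1 < n) (S : Subalgebra F A)
    (e : S ≃ₐ[F] Matrix (Fin n) (Fin n) F) :
    ∃ a b : Fin n → A, ∑ i, a i * b i = 1 ∧ ∀ i, b i * b i = 0 ∧ IsIdempotentElem (a i * b i) := by
  have : Nontrivial (Fin n) := Fin.nontrivial_iff_two_le.2 hn
  choose σ hσ using fun i : Fin n => exists_ne i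
  let f : Matrix (Fin n) (Fin n) F →ₐ[F] A := S.val.comp e.symm.toAlgHom
  refine ⟨fun i => f (Matrix.single i (σ i) 1), fun i => f (Matrix.single (σ i) i 1), ?_,
    fun i => ⟨?_, ?_⟩⟩
  · simp only [← map_mul, ← map_sum, Matrix.single_mul_single_same, mul_one]
    rw [← map_one f, Matrix.matrix_eq_sum_single 1]
    congr 1
    refine Finset.sum_congr rfl fun i _ => ?_
    rw [Finset.sum_eq_single i (fun j _ hj => by
      rw [Matrix.one_apply_ne hj.symm, Matrix.single_zero]) (by simp), Matrix.one_apply_eq]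
  · rw [← map_mul, Matrix.single_mul_single_of_ne _ _ _ _ (hσ i).symm, map_zero]
  · rw [← map_mul]
    refine IsIdempotentElem.map ?_ f
    simp [IsIdempotentElem]

/-- The homomorphic and antihomomorphic parts on the matrix subalgebras fit together: they are
`e * ψ` and `(1 - e) * ψ` for one idempotent `e` that commutes with the image of `ψ`. -/
theorem exists_idempotent_split (hA : IsLocallyMatrix F A) (h2 : (2 : F) ≠ 0) (ψ : A →ₗ[F] B)
    (hψ1 : ψ 1 = 1) (hψ : ∀ a, IsIdempotentElem a → IsIdempotentElem (ψ a)) :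
    ∃ e : B, IsIdempotentElem e ∧ (∀ x, e * ψ x = ψ x * e) ∧
      (∀ x y, e * ψ (x * y) = e * ψ x * (e * ψ y)) ∧
      ∀ x y, (1 - e) * ψ (x * y) = (1 - e) * ψ y * ((1 - e) * ψ x) := by
  classical
  by_cases hab : ∃ (n : ℕ) (a b : Fin n → A), ∑ i, a i * b i = 1 ∧
      ∀ i, b i * b i = 0 ∧ IsIdempotentElem (a i * b i)
  · obtain ⟨n, a, b, hsum, hab⟩ := hab
    set e : B := ∑ i, ψ (a i) * ψ (b i) * ψ (a i * b i) with he
    have key : ∀ x y : A, ∃ (S : Subalgebra F A) (_ : x ∈ S) (_ : y ∈ S) (ψ₁ ψ₂ : S →ₗ[F] B),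
        IsHomAddAntihom (ψ ∘ₗ S.val.toLinearMap) ψ₁ ψ₂ ∧ ψ₁ 1 = e := by
      intro x y
      obtain ⟨m, hm, S, hS, ⟨g⟩⟩ :=
        hA ({x, y} ∪ (Finset.univ.image a ∪ Finset.univ.image b))
      have ha : ∀ i, a i ∈ S := fun i => hS (by simp)
      have hb : ∀ i, b i ∈ S := fun i => hS (by simp)
      obtain ⟨ψ₁, ψ₂, h⟩ := exists_isHomAddAntihom_subalgebra h2 ψ hψ1 hψ hm S g
      refine ⟨S, hS (by simp), hS (by simp), ψ₁, ψ₂, h, ?_⟩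
      have h1 : (1 : S) = ∑ i, (⟨a i, ha i⟩ : S) * ⟨b i, hb i⟩ := by
        apply Subtype.ext
        simp [hsum]
      rw [h1, map_sum, he]
      refine Finset.sum_congr rfl fun i _ => ?_
      exact (h.mul_mul_eq (a := ⟨a i, ha i⟩) (b := ⟨b i, hb i⟩) (Subtype.ext (hab i).1)
        (Subtype.ext (hab i).2)).symm
    refine ⟨e, ?_, fun x => ?_, fun x y => ?_, fun x y => ?_⟩
    · obtain ⟨S, -, -, ψ₁, ψ₂, h, h1⟩ := key 0 0
      rw [← h1, IsIdempotentElem, ← h.map_mul₁, one_mul]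
    · obtain ⟨S, hx, -, ψ₁, ψ₂, h, h1⟩ := key x x
      rw [← h1]
      exact (h.map_one_mul ⟨x, hx⟩).trans (h.mul_map_one ⟨x, hx⟩).symm
    · obtain ⟨S, hx, hy, ψ₁, ψ₂, h, h1⟩ := key x y
      have hS : ∀ z (hz : z ∈ S), e * ψ z = ψ₁ ⟨z, hz⟩ := fun z hz => by
        rw [← h1]; exact h.map_one_mul ⟨z, hz⟩
      rw [hS x hx, hS y hy, hS _ (S.mul_mem hx hy), ← h.map_mul₁]
      rfl
    · obtain ⟨S, hx, hy, ψ₁, ψ₂, h, h1⟩ := key x y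
      have hS : ∀ z (hz : z ∈ S), (1 - e) * ψ z = ψ₂ ⟨z, hz⟩ := fun z hz => by
        rw [← h1]; exact h.one_sub_mul ⟨z, hz⟩
      rw [hS x hx, hS y hy, hS _ (S.mul_mem hx hy), ← h.map_mul₂]
      rfl
  · -- Here every matrix subalgebra has size one, so `A` consists of scalars.
    refine ⟨1, IsIdempotentElem.one, by simp, fun x y => ?_, by simp⟩
    obtain ⟨n, hn, S, hS, ⟨g⟩⟩ := hA {x}
    rcases hn.eq_or_lt with rfl | hn
    · obtain ⟨t, ht⟩ := exists_eq_algebraMap_of_algEquiv_matrix_one g (hS (by simp) : x ∈ S)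
      simp [ht, Algebra.algebraMap_eq_smul_one, hψ1]
    · exact absurd ⟨n, exists_sum_mul_eq_one hn S g⟩ hab

end Gluing

theorem theorem1 {F A B : Type*} [Field F] [Ring A] [Algebra F A] [Ring B] [Algebra F B]
    (hchar : ringChar F ≠ 2) (hA : IsLocallyMatrix F A) (hB : IsLocallyMatrix F B)
    (φ : A →ₗ[F] B) (hφ : ∀ a : A, normalizedRank F (φ a) = normalizedRank F a) :
    ∃ e₁ e₂ : B, IsIdempotentElem e₁ ∧ IsIdempotentElem e₂ ∧ e₁ * e₂ = 0 ∧ e₂ * e₁ = 0 ∧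
      e₁ + e₂ = 1 ∧
      ∃ φ₁ φ₂ : A →ₗ[F] B,
        -- `φ₁ : A → e₁ B e₁` is a homomorphism with `φ₁ 1 = e₁`
        (∀ a, φ₁ a ∈ Subsemigroup.corner e₁) ∧ (∀ a b, φ₁ (a * b) = φ₁ a * φ₁ b) ∧ φ₁ 1 = e₁ ∧
        -- `φ₂ : A → e₂ B e₂` is an antihomomorphism with `φ₂ 1 = e₂`
        (∀ a, φ₂ a ∈ Subsemigroup.corner e₂) ∧ (∀ a b, φ₂ (a * b) = φ₂ b * φ₂ a) ∧ φ₂ 1 = e₂ ∧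
        ∃ X Y : Bˣ, ∀ a, φ a = X * (φ₁ a + φ₂ a) * Y := by
  obtain ⟨u, hu⟩ := hB.isUnit_of_normalizedRank_eq_one ((hφ 1).trans hA.normalizedRank_one)
  let ψ : A →ₗ[F] B := LinearMap.mulLeft F (↑u⁻¹ : B) ∘ₗ φ
  have hψ_apply : ∀ a, ψ a = ↑u⁻¹ * φ a := fun a => rfl
  have hψ1 : ψ 1 = 1 := by rw [hψ_apply, ← hu, Units.inv_mul]
  have hψ : ∀ a, IsIdempotentElem a → IsIdempotentElem (ψ a) := by
    intro a ha
    have hrank : ∀ x, normalizedRank F (ψ x) = normalizedRank F x := fun x => by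
      rw [hψ_apply, hB.normalizedRank_units_mul, hφ]
    apply hB.isIdempotentElem_of_normalizedRank_add
    rw [← hψ1, ← map_sub, hrank, hrank, hA.normalizedRank_add_one_sub ha]
  obtain ⟨e, he, hcomm, hmul, hantimul⟩ :=
    exists_idempotent_split hA (Ring.two_ne_zero hchar) ψ hψ1 hψ
  have hcomm' : ∀ x, (1 - e) * ψ x = ψ x * (1 - e) := fun x => by
    rw [sub_mul, mul_sub, hcomm, one_mul, mul_one]
  refine ⟨e, 1 - e, he, he.one_sub, by rw [mul_sub, mul_one, he.eq, sub_self],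
    by rw [sub_mul, one_mul, he.eq, sub_self], add_sub_cancel _ _,
    LinearMap.mulLeft F e ∘ₗ ψ, LinearMap.mulLeft F (1 - e) ∘ₗ ψ,
    fun a => ?_, hmul, ?_, fun a => ?_, hantimul, ?_, u, 1, fun a => ?_⟩
  · rw [Subsemigroup.mem_corner_iff he]
    simp only [LinearMap.comp_apply, LinearMap.mulLeft_apply]
    constructor
    · rw [← mul_assoc, he.eq]
    · rw [mul_assoc, ← hcomm, ← mul_assoc, he.eq]
  · simp [hψ1]
  · rw [Subsemigroup.mem_corner_iff he.one_sub]
    simp only [LinearMap.comp_apply, LinearMap.mulLeft_apply]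
    constructor
    · rw [← mul_assoc, he.one_sub.eq]
    · rw [mul_assoc, ← hcomm', ← mul_assoc, he.one_sub.eq]
  · simp [hψ1]
  · simp only [LinearMap.comp_apply, LinearMap.mulLeft_apply, ← add_mul, add_sub_cancel, one_mul,
      hψ_apply, Units.mul_inv_cancel_left, Units.val_one, mul_one]
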